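/- Let $K,n\ge 1$ and $d>K$ be integers, let $\lambda_W,\lambda_H>0$ with $\lambda_H\lambda_W<1$, and let $\beta>\sqrt{\lambda_H/\lambda_W}$. Let $\mathbf Y=\mathbf I_K\otimes\mathbf 1_n^\top\in\mathbb R^{K\times Kn}$. For $\mathbf W\in\mathbb R^{K\times d}$ and $\mathbf H\in\mathbb R^{d\times Kn}$, whose columns are ordered by class ($n$ consecutive columns per class), put $$g(\mathbf W,\mathbf H)=\frac1{2Kn}\|\mathbf W\mathbf H-\mathbf Y\|_F^2+\frac{\lambda_W}{2K}\|\mathbf W\|_F^2+\frac{\lambda_H}{2Kn}\|\mathbf H\|_F^2,\qquad f(\mathbf W,\mathbf H;\mathbf H_0)=g(\mathbf W,\mathbf H)+\frac{\beta}{2Kn}\|\mathbf H-\mathbf H_0\|_F^2 .$$ Let $\mathbf H_0$ be the feature matrix of a global minimizer $(\mathbf W_0,\mathbf H_0)$ of the unconstrained features model $\min g$ (such an $\mathbf H_0$ is exactly collapsed), and let $(\mathbf W,\mathbf H)$ be a global minimizer of $f(\cdot,\cdot;\mathbf H_0)$. Define $$\mathbf F=\mathbf I_{dnK}-\frac{\lambda_H}{\beta}\mathbf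 I_{dnK}-\frac1\beta\,\mathbf I_{nK}\otimes\mathbf W^\top\mathbf W+\frac1\beta\mathbf Z,$$ $$\mathbf Z=(\mathbf E^\top+\mathbf H\otimes\mathbf W)^\top\big(\mathbf H\mathbf H^\top\otimes\mathbf I_K+n\lambda_W\mathbf I_{dK}\big)^{-1}(\mathbf E^\top+\mathbf H\otimes\mathbf W),$$ where the $((i-1)K+k)$-th column of $\mathbf E\in\mathbb R^{dnK\times Kd}$ ($i\in[d]$, $k\in[K]$) is $\mathrm{vec}\big(\mathbf e_{d,i}\mathbf e_{K,k}^\top(\mathbf W\mathbf H-\mathbf Y)\big)$, $\mathrm{vec}$ being column-stacking and $\mathbf e_{m,j}$ the $j$-th standard basis vector of $\mathbb R^m$. Divide $\mathbf F$ into $K\times K$ blocks $\mathbf F_{k,\tilde k}\in\mathbb R^{dn\times dn}$, indexed by classes. Write $\sigma_{\max}$ and $\sigma_{\min}$ for the largest and the smallest singular value. Then for every $k\in[K]$ the intra-class block $\mathbf F_{k,k}$ has full rank $dn$ and $\sigma_{\max}(\mathbf F_{k,k})=1$; if moreover $n\ge 2$, then $$\sigma_{\min}(\mathbf F_{k,k})=1-\beta^{-1}\sqrt{\lambda_H/\lambda_W}.$$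 For all $k\ne\tilde k$ in $[K]$ the inter-class block $\mathbf F_{k,\tilde k}$ has rank one and $$\sigma_{\max}(\mathbf F_{k,\tilde k})=2\beta^{-1}\lambda_H\big(1-\sqrt{\lambda_H\lambda_W}\big).$$ -/

import Mathlib

open scoped Matrix Kronecker

noncomputable section

namespace UFM

/-- Squared Frobenius norm of a real matrix. -/
def frobSq {m p : Type*} [Fintype m] [Fintype p] (A : Matrix m p ℝ) : ℝ :=
  ∑ i, ∑ j, A i j ^ 2

/-- Index set of the `K * n` columns (samples): the pair `(k, i)` is the `i`-th sample of the
`k`-th class. -/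
abbrev Smp (K n : ℕ) : Type := Fin K × Fin n

/-- The one-hot label matrix `Y = I_K ⊗ 1_nᵀ`. -/
def labels (K n : ℕ) : Matrix (Fin K) (Smp K n) ℝ :=
  Matrix.of fun k a => if k = a.1 then 1 else 0

/-- The objective of the regularized, bias-free unconstrained features model with MSE loss. -/
def ufmLoss {d K n : ℕ} (lamW lamH : ℝ)
    (W : Matrix (Fin K) (Fin d) ℝ) (H : Matrix (Fin d) (Smp K n) ℝ) : ℝ :=
  1 / (2 * K * n) * frobSq (W * H - labels K n)
    + lamW / (2 * K) * frobSq W + lamH / (2 * K * n) * frobSq H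

/-- The objective `f(W, H; H₀)`, which in addition penalizes the distance of `H` from the fixed
input features `H₀`. -/
def penLoss {d K n : ℕ} (lamW lamH β : ℝ) (H₀ : Matrix (Fin d) (Smp K n) ℝ)
    (W : Matrix (Fin K) (Fin d) ℝ) (H : Matrix (Fin d) (Smp K n) ℝ) : ℝ :=
  1 / (2 * K * n) * frobSq (W * H - labels K n)
    + lamW / (2 * K) * frobSq W + lamH / (2 * K * n) * frobSq H
    + β / (2 * K * n) * frobSq (H - H₀)

/-- `(W, H)` is a global minimizer of the unconstrained features model. -/
def IsUfmMinimizer {d K n : ℕ} (lamW lamH : ℝ)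
    (W : Matrix (Fin K) (Fin d) ℝ) (H : Matrix (Fin d) (Smp K n) ℝ) : Prop :=
  ∀ (W' : Matrix (Fin K) (Fin d) ℝ) (H' : Matrix (Fin d) (Smp K n) ℝ),
    ufmLoss lamW lamH W H ≤ ufmLoss lamW lamH W' H'

/-- `(W, H)` is a global minimizer of `f(·, ·; H₀)`. -/
def IsPenMinimizer {d K n : ℕ} (lamW lamH β : ℝ) (H₀ : Matrix (Fin d) (Smp K n) ℝ)
    (W : Matrix (Fin K) (Fin d) ℝ) (H : Matrix (Fin d) (Smp K n) ℝ) : Prop :=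
  ∀ (W' : Matrix (Fin K) (Fin d) ℝ) (H' : Matrix (Fin d) (Smp K n) ℝ),
    penLoss lamW lamH β H₀ W H ≤ penLoss lamW lamH β H₀ W' H'

/-- The `dnK × Kd` matrix `E` whose column of index `(i, k)` is
`vec (e_{d,i} e_{K,k}ᵀ (W H - Y))`, with `vec` the column-stack vectorization
(`Matrix.vec A (j, i) = A i j`). -/
def matE {d K n : ℕ} (W : Matrix (Fin K) (Fin d) ℝ) (H : Matrix (Fin d) (Smp K n) ℝ) :
    Matrix (Smp K n × Fin d) (Fin d × Fin K) ℝ :=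
  Matrix.of fun r c => Matrix.vec (Matrix.single c.1 c.2 (1 : ℝ) * (W * H - labels K n)) r

/-- `Z = (Eᵀ + H ⊗ W)ᵀ (H Hᵀ ⊗ I_K + n λ_W I_{dK})⁻¹ (Eᵀ + H ⊗ W)`. -/
def matZ {d K n : ℕ} (lamW : ℝ)
    (W : Matrix (Fin K) (Fin d) ℝ) (H : Matrix (Fin d) (Smp K n) ℝ) :
    Matrix (Smp K n × Fin d) (Smp K n × Fin d) ℝ :=
  ((matE W H)ᵀ + H ⊗ₖ W)ᵀ
    * ((H * Hᵀ) ⊗ₖ (1 : Matrix (Fin K) (Fin K) ℝ)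
        + ((n : ℝ) * lamW) • (1 : Matrix (Fin d × Fin K) (Fin d × Fin K) ℝ))⁻¹
    * ((matE W H)ᵀ + H ⊗ₖ W)

/-- The `dnK × dnK` matrix
`F = I - (λ_H / β) I - (1 / β) I_{nK} ⊗ WᵀW + (1 / β) Z`. -/
def matF {d K n : ℕ} (lamW lamH β : ℝ)
    (W : Matrix (Fin K) (Fin d) ℝ) (H : Matrix (Fin d) (Smp K n) ℝ) :
    Matrix (Smp K n × Fin d) (Smp K n × Fin d) ℝ :=
  1 - (lamH / β) • (1 : Matrix (Smp K n × Fin d) (Smp K n × Fin d) ℝ)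
    - (1 / β) • ((1 : Matrix (Smp K n) (Smp K n) ℝ) ⊗ₖ (Wᵀ * W))
    + (1 / β) • matZ lamW W H

/-- The `dn × dn` block of a `dnK × dnK` matrix whose rows belong to class `k` and whose columns
belong to class `l`. -/
def classBlock {d K n : ℕ} (F : Matrix (Smp K n × Fin d) (Smp K n × Fin d) ℝ) (k l : Fin K) :
    Matrix (Fin n × Fin d) (Fin n × Fin d) ℝ :=
  F.submatrix (fun p => ((k, p.1), p.2)) (fun p => ((l, p.1), p.2))

/-- The largest singular value of a real matrix (`LinearMap.singularValues` lists them in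
descending order, starting from index `0`). -/
def sigmaMax {m p : Type*} [Fintype m] [Fintype p] [DecidableEq m] [DecidableEq p]
    (A : Matrix m p ℝ) : ℝ :=
  (Matrix.toEuclideanLin A).singularValues 0

/-- The smallest of the `min (#rows) (#columns)` singular values of a nonempty real matrix. -/
def sigmaMin {m p : Type*} [Fintype m] [Fintype p] [DecidableEq m] [DecidableEq p]
    (A : Matrix m p ℝ) : ℝ :=
  (Matrix.toEuclideanLin A).singularValues (min (Fintype.card m) (Fintype.card p) - 1)

end UFM

end

namespace UFM

open Matrix

/-! ### Singular values of symmetric and rank-one matrices -/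

section SingularValues

variable {m p : Type*} [Fintype m] [Fintype p] [DecidableEq m] [DecidableEq p]

/-! The proof makes `F` explicit. Write `p = √λ_H`, `q = √λ_W`. The competitor `(W₀, H₀)` has zero
penalty, so a minimizer of `f` also minimizes `g` (`IsPenMinimizer.isUfmMinimizer`). Up to a
constant, `g` is a sum of two squares that can vanish together, which forces `H = (q/p) WᵀY`, `WH =
(1 - pq) Y` and `WWᵀ = a I` with `a = (1 - pq)p/q` (`IsUfmMinimizer.collapse`).

These identities give the inverse in `Z`, then `Z` itself, in closed form (`matZ_apply`). Let `R` be
averaging over samples, `P = a⁻¹WᵀW`, and `U` the projection onto row `k` of `W`. The intra-class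
block is a combination of tensor products of these commuting projections (`classBlock_self`), with
eigenvalues among `1`, `1 - p²/β`, `1 - (p/q)/β`, `1 - γ/β`, `1 - 2γ/β`, where `γ = 2p²(1 - pq)`.
Since `p²` and `2γ` are at most `p/q < β`, all lie in `[1 - (p/q)/β, 1]` and are positive
(`spectrum_blockForm`). Inter-class blocks are outer products of two rows of `W`
(`classBlock_of_ne`). -/

theorem adjoint_comp_toEuclideanLin (A : Matrix m p ℝ) :
    LinearMap.adjoint (toEuclideanLin A) ∘ₗ toEuclideanLin A = toEuclideanLin (Aᵀ * A) := by
  rw [← toEuclideanLin_conjTranspose_eq_adjoint, conjTranspose_eq_transpose_of_trivial]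
  ext x i
  simp [toLpLin_apply, mulVec_mulVec]

theorem exists_mulVec_eq_sq_singularValues (A : Matrix m p ℝ) {i : ℕ} (hi : i < Fintype.card p) :
    ∃ x : p → ℝ, x ≠ 0 ∧ (Aᵀ * A) *ᵥ x = (toEuclideanLin A).singularValues i ^ 2 • x := by
  have h := (toEuclideanLin A).hasEigenvalue_adjoint_comp_self_sq_singularValues
    (n := i) (by simpa using hi)
  obtain ⟨v, hv⟩ := h.exists_hasEigenvector
  refine ⟨v.ofLp, fun h0 => hv.2 (by ext j; simp [h0]), ?_⟩
  have h1 := hv.apply_eq_smul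
  rw [adjoint_comp_toEuclideanLin] at h1
  simpa [toLpLin_apply] using congrArg WithLp.ofLp h1

theorem exists_singularValues_eq (A : Matrix m p ℝ) {σ : ℝ} (hσ : 0 ≤ σ) {x : p → ℝ} (hx : x ≠ 0)
    (h : (Aᵀ * A) *ᵥ x = σ ^ 2 • x) :
    ∃ i < Fintype.card p, (toEuclideanLin A).singularValues i = σ := by
  set T := toEuclideanLin A
  have hev : Module.End.HasEigenvalue (LinearMap.adjoint T ∘ₗ T) (σ ^ 2) := by
    refine Module.End.hasEigenvalue_of_hasEigenvector (x := WithLp.toLp 2 x) ⟨?_, ?_⟩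
    · rw [Module.End.mem_eigenspace_iff, adjoint_comp_toEuclideanLin, toLpLin_toLp, toLin'_apply, h,
        WithLp.toLp_smul]
    · simpa using hx
  obtain ⟨i, hi⟩ := T.isSymmetric_adjoint_comp_self.exists_eigenvalues_eq
    (finrank_euclideanSpace (𝕜 := ℝ) (ι := p)) hev
  refine ⟨i, i.2, ?_⟩
  rw [T.singularValues_fin finrank_euclideanSpace i]
  have hi' : T.isSymmetric_adjoint_comp_self.eigenvalues finrank_euclideanSpace i = σ ^ 2 := by
    simpa using hi
  rw [hi', Real.sqrt_sq hσ]

theorem sigmaMax_eq_of_forall_le (A : Matrix m p ℝ) {σ : ℝ} (hσ : 0 ≤ σ) {x : p → ℝ} (hx : x ≠ 0)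
    (h : (Aᵀ * A) *ᵥ x = σ ^ 2 • x)
    (hle : ∀ i < Fintype.card p, (toEuclideanLin A).singularValues i ≤ σ) : sigmaMax A = σ := by
  obtain ⟨i, hi, his⟩ := exists_singularValues_eq A hσ hx h
  refine le_antisymm (hle 0 (by omega)) ?_
  rw [← his]
  exact (toEuclideanLin A).singularValues_antitone (Nat.zero_le i)

theorem sigmaMin_eq_of_forall_le (A : Matrix m m ℝ) {σ : ℝ} (hσ : 0 ≤ σ) {x : m → ℝ} (hx : x ≠ 0)
    (h : (Aᵀ * A) *ᵥ x = σ ^ 2 • x)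
    (hle : ∀ i < Fintype.card m, σ ≤ (toEuclideanLin A).singularValues i) : sigmaMin A = σ := by
  obtain ⟨i, hi, his⟩ := exists_singularValues_eq A hσ hx h
  rw [sigmaMin, min_self]
  refine le_antisymm ?_ (hle _ (by omega))
  rw [← his]
  exact (toEuclideanLin A).singularValues_antitone (by omega)

omit [DecidableEq m] in
theorem transpose_mul_self_mulVec_of_eigenvector {A : Matrix m m ℝ} (hA : A.IsSymm) {σ : ℝ}
    {x : m → ℝ} (h : A *ᵥ x = σ • x) : (Aᵀ * A) *ᵥ x = σ ^ 2 • x := by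
  rw [hA.eq, ← mulVec_mulVec, h, mulVec_smul, h, smul_smul, sq]

/-- For positive definite `A`, singular values are eigenvalues: if `A²x = σ²x`, then `Ax - σx` would
be an eigenvector for `-σ ≤ 0`, so it vanishes. The Loewner bounds then apply to `σ`. -/
theorem singularValues_mem_Icc {A : Matrix m m ℝ} (hA : A.IsSymm) {μ M : ℝ} (hμ : 0 < μ)
    (h₁ : (A - μ • 1).PosSemidef) (h₂ : (M • 1 - A).PosSemidef) {i : ℕ}
    (hi : i < Fintype.card m) : (toEuclideanLin A).singularValues i ∈ Set.Icc μ M := by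
  obtain ⟨x, hx, h⟩ := exists_mulVec_eq_sq_singularValues A hi
  set σ := (toEuclideanLin A).singularValues i
  have hσ : 0 ≤ σ := (toEuclideanLin A).singularValues_nonneg i
  have low (y : m → ℝ) : μ * (y ⬝ᵥ y) ≤ y ⬝ᵥ A *ᵥ y := by
    have := h₁.dotProduct_mulVec_nonneg y
    simpa [sub_mulVec, smul_mulVec] using this
  have up (y : m → ℝ) : y ⬝ᵥ A *ᵥ y ≤ M * (y ⬝ᵥ y) := by
    have := h₂.dotProduct_mulVec_nonneg y
    simpa [sub_mulVec, smul_mulVec] using this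
  have pos {y : m → ℝ} (hy : y ≠ 0) : 0 < y ⬝ᵥ y := by
    simpa using dotProduct_star_self_pos_iff.2 hy
  rw [hA.eq, ← mulVec_mulVec] at h
  have hy : A *ᵥ x - σ • x = 0 := by
    by_contra hne
    have h1 : A *ᵥ (A *ᵥ x - σ • x) = -σ • (A *ᵥ x - σ • x) := by
      rw [mulVec_sub, h, mulVec_smul, smul_sub, smul_smul]
      ext j
      simp only [Pi.sub_apply, Pi.smul_apply, smul_eq_mul]
      ring
    have h2 := low (A *ᵥ x - σ • x)
    rw [h1, dotProduct_smul, smul_eq_mul] at h2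
    nlinarith [pos hne]
  have hσx : A *ᵥ x = σ • x := sub_eq_zero.1 hy
  have h3 := low x
  have h4 := up x
  rw [hσx, dotProduct_smul, smul_eq_mul] at h3 h4
  exact ⟨le_of_mul_le_mul_right h3 (pos hx), le_of_mul_le_mul_right h4 (pos hx)⟩

theorem rank_eq_card_of_posSemidef_sub {A : Matrix m m ℝ} {μ : ℝ} (hμ : 0 < μ)
    (h : (A - μ • 1).PosSemidef) : A.rank = Fintype.card m := by
  have hpd : A.PosDef := by
    have := (PosDef.one (n := m) (R := ℝ)).smul hμ
    simpa using this.add_posSemidef h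
  exact rank_of_isUnit A hpd.isUnit

omit [DecidableEq m] [DecidableEq p] in
theorem transpose_mul_self_vecMulVec (u : m → ℝ) (v x : p → ℝ) :
    ((vecMulVec u v)ᵀ * vecMulVec u v) *ᵥ x = ((u ⬝ᵥ u) * (v ⬝ᵥ x)) • v := by
  rw [transpose_vecMulVec, vecMulVec_mul_vecMulVec, vecMulVec_mulVec, smul_dotProduct,
    op_smul_eq_smul, smul_eq_mul]

theorem sigmaMax_vecMulVec {u : m → ℝ} {v : p → ℝ} (hv : v ≠ 0) {σ : ℝ} (hσ : 0 ≤ σ)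
    (h : σ ^ 2 = (u ⬝ᵥ u) * (v ⬝ᵥ v)) : sigmaMax (vecMulVec u v) = σ := by
  refine sigmaMax_eq_of_forall_le _ hσ hv ?_ fun i hi => ?_
  · rw [transpose_mul_self_vecMulVec, h]
  · obtain ⟨x, hx, hxi⟩ := exists_mulVec_eq_sq_singularValues (vecMulVec u v) hi
    rw [transpose_mul_self_vecMulVec] at hxi
    set τ := (toEuclideanLin (vecMulVec u v)).singularValues i
    -- Pairing the eigenvector equation with `v` shows that `τ > σ` forces `v ⬝ᵥ x = 0`, hence `τ² x
    -- = 0`.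
    by_contra! hlt
    have hτ : σ ^ 2 < τ ^ 2 := by gcongr
    have h1 := congrArg (v ⬝ᵥ ·) hxi
    simp only [dotProduct_smul, smul_eq_mul] at h1
    have h0 : v ⬝ᵥ x = 0 := by
      have : (τ ^ 2 - σ ^ 2) * (v ⬝ᵥ x) = 0 := by rw [h]; linarith
      exact (mul_eq_zero.1 this).resolve_left (by linarith)
    rw [h0, mul_zero, zero_smul] at hxi
    exact (smul_ne_zero (by nlinarith [sq_nonneg σ]) hx) hxi.symm

omit [Fintype m] [DecidableEq m] [DecidableEq p] in
theorem rank_vecMulVec_eq_one {u : m → ℝ} {v : p → ℝ} (hu : u ≠ 0) (hv : v ≠ 0) :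
    (vecMulVec u v).rank = 1 := by
  refine le_antisymm (rank_vecMulVec_le u v) (Nat.one_le_iff_ne_zero.2 fun h => ?_)
  rw [rank, Submodule.finrank_eq_zero, LinearMap.range_eq_bot] at h
  have h1 : (v ⬝ᵥ v) • u = 0 := by
    simpa [vecMulVec_mulVec] using LinearMap.congr_fun h v
  exact smul_ne_zero (dotProduct_self_eq_zero.not.2 hv) hu h1

omit [DecidableEq m] in
theorem posSemidef_of_isSymm_of_mul_self {A : Matrix m m ℝ} (hs : Aᵀ = A) (h : A * A = A) :
    A.PosSemidef := by
  have := posSemidef_conjTranspose_mul_self A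
  rwa [conjTranspose_eq_transpose_of_trivial, hs, h] at this

end SingularValues

/-! ### Collapse of the global minimizers -/

section Minimizers

section FrobSq

variable {m p : Type*} [Fintype m] [Fintype p]

theorem frobSq_nonneg (A : Matrix m p ℝ) : 0 ≤ frobSq A :=
  Finset.sum_nonneg fun _ _ => Finset.sum_nonneg fun _ _ => sq_nonneg _

theorem eq_zero_of_frobSq_eq_zero {A : Matrix m p ℝ} (h : frobSq A = 0) : A = 0 := by
  ext i j
  have h1 := (Finset.sum_eq_zero_iff_of_nonneg fun i _ =>
    Finset.sum_nonneg fun j _ => sq_nonneg (A i j)).1 h i (Finset.mem_univ i)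
  have h2 := (Finset.sum_eq_zero_iff_of_nonneg fun j _ => sq_nonneg (A i j)).1 h1 j
    (Finset.mem_univ j)
  simpa using h2

theorem frobSq_zero : frobSq (0 : Matrix m p ℝ) = 0 := by simp [frobSq]

theorem frobSq_eq_trace (A : Matrix m p ℝ) : frobSq A = (Aᵀ * A).trace := by
  simp only [frobSq, trace, diag_apply, mul_apply, transpose_apply, sq]
  exact Finset.sum_comm

theorem frobSq_smul_sub_smul (A B : Matrix m p ℝ) (s t : ℝ) :
    frobSq (s • A - t • B) =
      s ^ 2 * frobSq A - 2 * s * t * (Aᵀ * B).trace + t ^ 2 * frobSq B := by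
  have h : (Bᵀ * A).trace = (Aᵀ * B).trace := by
    rw [← trace_transpose, transpose_mul, transpose_transpose]
  simp only [frobSq_eq_trace, transpose_sub, transpose_smul, Matrix.sub_mul, Matrix.mul_sub,
    Matrix.smul_mul, Matrix.mul_smul, trace_sub, trace_smul, smul_eq_mul, h]
  ring

end FrobSq

variable {d K n : ℕ}

theorem labels_mul_transpose : labels K n * (labels K n)ᵀ = (n : ℝ) • 1 := by
  ext k l
  simp only [mul_apply, labels, transpose_apply, of_apply, Fintype.sum_prod_type,
    Matrix.smul_apply, smul_eq_mul, one_apply]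
  rw [Finset.sum_eq_single k (by intro b _ hb; simp [hb.symm]) (by simp)]
  by_cases h : k = l <;> simp [h, Ne.symm]

theorem frobSq_transpose_mul_labels (W : Matrix (Fin K) (Fin d) ℝ) :
    frobSq (Wᵀ * labels K n) = n * frobSq W := by
  rw [frobSq_eq_trace, transpose_mul, transpose_transpose, trace_mul_comm, Matrix.mul_assoc,
    ← Matrix.mul_assoc (labels K n), labels_mul_transpose, Matrix.smul_mul, Matrix.one_mul,
    Matrix.mul_smul, trace_smul, smul_eq_mul, frobSq_eq_trace]

/-- Completion of squares for the loss of the unconstrained features model. -/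
theorem ufmLoss_eq (hK : 0 < K) (hn : 0 < n) (p q : ℝ)
    (W : Matrix (Fin K) (Fin d) ℝ) (H : Matrix (Fin d) (Smp K n) ℝ) :
    ufmLoss (q ^ 2) (p ^ 2) W H = 1 / (2 * K * n) *
      (frobSq (W * H - (1 - p * q) • labels K n) + frobSq (p • H - q • (Wᵀ * labels K n))
        + (1 - (1 - p * q) ^ 2) * frobSq (labels K n)) := by
  have h1 := frobSq_smul_sub_smul (W * H) (labels K n) 1 1
  have h2 := frobSq_smul_sub_smul (W * H) (labels K n) 1 (1 - p * q)
  have h3 := frobSq_smul_sub_smul H (Wᵀ * labels K n) p q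
  have h4 : (Hᵀ * (Wᵀ * labels K n)).trace = ((W * H)ᵀ * labels K n).trace := by
    rw [transpose_mul, Matrix.mul_assoc]
  rw [h4, frobSq_transpose_mul_labels] at h3
  simp only [one_smul] at h1 h2
  rw [ufmLoss, h1, h2, h3]
  have : (K : ℝ) ≠ 0 := by positivity
  have : (n : ℝ) ≠ 0 := by positivity
  field_simp
  ring

theorem exists_mul_transpose_eq_smul_one (hdK : K ≤ d) {a : ℝ} (ha : 0 ≤ a) :
    ∃ W : Matrix (Fin K) (Fin d) ℝ, W * Wᵀ = a • 1 := by
  refine ⟨Matrix.of fun k j => if Fin.castLE hdK k = j then √a else 0, ?_⟩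
  ext k l
  by_cases h : k = l
  · subst h
    simp [mul_apply, Real.mul_self_sqrt ha]
  · simp [mul_apply, h]

/-- Global minimizers of the unconstrained features model are collapsed. -/
theorem IsUfmMinimizer.collapse (hdK : K ≤ d) (hK : 0 < K) (hn : 0 < n) {p q : ℝ} (hp : 0 < p)
    (hq : 0 < q) (hpq : p * q < 1) {W : Matrix (Fin K) (Fin d) ℝ}
    {H : Matrix (Fin d) (Smp K n) ℝ} (h : IsUfmMinimizer (q ^ 2) (p ^ 2) W H) :
    H = (q / p) • (Wᵀ * labels K n) ∧ W * H = (1 - p * q) • labels K n ∧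
      W * Wᵀ = ((1 - p * q) * p / q) • 1 := by
  have ha : 0 ≤ (1 - p * q) * p / q := div_nonneg (mul_nonneg (by linarith) hp.le) hq.le
  obtain ⟨W', hW'⟩ := exists_mul_transpose_eq_smul_one hdK ha
  -- This competitor makes both squares of `ufmLoss_eq` zero, so they vanish at every minimizer.
  have hmin := h W' ((q / p) • (W'ᵀ * labels K n))
  have e1 : W' * ((q / p) • (W'ᵀ * labels K n)) - (1 - p * q) • labels K n = 0 := by
    rw [Matrix.mul_smul, ← Matrix.mul_assoc, hW', Matrix.smul_mul, Matrix.one_mul, smul_smul,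
      sub_eq_zero]
    congr 1
    field_simp
  have e2 : p • ((q / p) • (W'ᵀ * labels K n)) - q • (W'ᵀ * labels K n) = 0 := by
    rw [smul_smul, mul_div_cancel₀ _ hp.ne', sub_self]
  rw [ufmLoss_eq hK hn, ufmLoss_eq hK hn, e1, e2, frobSq_zero, frobSq_zero] at hmin
  have hpos : (0 : ℝ) < 1 / (2 * K * n) := by positivity
  have hle := le_of_mul_le_mul_left hmin hpos
  have n1 := frobSq_nonneg (W * H - (1 - p * q) • labels K n)
  have n2 := frobSq_nonneg (p • H - q • (Wᵀ * labels K n))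
  have z1 := sub_eq_zero.1 (eq_zero_of_frobSq_eq_zero
    (by linarith : frobSq (W * H - (1 - p * q) • labels K n) = 0))
  have z2 := sub_eq_zero.1 (eq_zero_of_frobSq_eq_zero
    (by linarith : frobSq (p • H - q • (Wᵀ * labels K n)) = 0))
  have hH : H = (q / p) • (Wᵀ * labels K n) := by
    rw [div_eq_inv_mul, mul_smul, ← z2, smul_smul, inv_mul_cancel₀ hp.ne', one_smul]
  refine ⟨hH, z1, ?_⟩
  have hn' : (n : ℝ) ≠ 0 := by positivity
  rw [hH] at z1
  -- The labels cancel because `Y Yᵀ = n I`.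
  have h3 := congrArg (· * (labels K n)ᵀ) z1
  simp only [Matrix.mul_smul, Matrix.smul_mul, Matrix.mul_assoc, labels_mul_transpose,
    Matrix.mul_one, smul_smul] at h3
  have h4 := congrArg ((p / q / n) • ·) h3
  simp only [smul_smul] at h4
  convert! h4 using 1
  · rw [show p / q / n * (q / p * n) = 1 by field_simp, one_smul]
  · congr 1
    field_simp

theorem IsPenMinimizer.isUfmMinimizer {lamW lamH β : ℝ} (hβ : 0 ≤ β)
    {H₀ : Matrix (Fin d) (Smp K n) ℝ}
    (hH₀ : ∃ W₀ : Matrix (Fin K) (Fin d) ℝ, IsUfmMinimizer lamW lamH W₀ H₀)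
    {W : Matrix (Fin K) (Fin d) ℝ} {H : Matrix (Fin d) (Smp K n) ℝ}
    (h : IsPenMinimizer lamW lamH β H₀ W H) : IsUfmMinimizer lamW lamH W H := by
  obtain ⟨W₀, h₀⟩ := hH₀
  intro W' H'
  refine le_trans ?_ (h₀ W' H')
  have h1 := h W₀ H₀
  have h2 : 0 ≤ β / (2 * K * n) * frobSq (H - H₀) :=
    mul_nonneg (by positivity) (frobSq_nonneg _)
  rw [penLoss, penLoss, sub_self, frobSq_zero, mul_zero, add_zero] at h1
  rw [ufmLoss, ufmLoss]
  linarith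

end Minimizers

/-! ### Closed form of `Z` at a collapsed pair -/

section Blocks

variable {d K n : ℕ} {p q : ℝ} {W : Matrix (Fin K) (Fin d) ℝ} {H : Matrix (Fin d) (Smp K n) ℝ}

theorem dotProduct_row_row {a : ℝ} (hWW : W * Wᵀ = a • 1) (k l : Fin K) :
    ∑ i, W k i * W l i = if k = l then a else 0 := by
  have := congrFun (congrFun hWW k) l
  simpa [mul_apply, one_apply] using this

theorem mul_transpose_mul {a : ℝ} (hWW : W * Wᵀ = a • 1) : W * (Wᵀ * W) = a • W := by
  rw [← Matrix.mul_assoc, hWW, Matrix.smul_mul, Matrix.one_mul]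

theorem transpose_mul_self_mul_self {a : ℝ} (hWW : W * Wᵀ = a • 1) :
    (Wᵀ * W) * (Wᵀ * W) = a • (Wᵀ * W) := by
  rw [Matrix.mul_assoc, mul_transpose_mul hWW, Matrix.mul_smul]

/-- `I - (q / p) WᵀW`, proportional to the inverse of `H Hᵀ + n q² I` at a collapsed pair. -/
noncomputable def gramInv (p q : ℝ) (W : Matrix (Fin K) (Fin d) ℝ) : Matrix (Fin d) (Fin d) ℝ :=
  1 - (q / p) • (Wᵀ * W)

/-- The rows of `W` are eigenvectors of `WᵀW` with eigenvalue `a`, and `1 - (q/p) a = pq`. -/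
theorem mul_gramInv (hp : 0 < p) (hq : 0 < q) (hWW : W * Wᵀ = ((1 - p * q) * p / q) • 1) :
    W * gramInv p q W = (p * q) • W := by
  rw [gramInv, Matrix.mul_sub, Matrix.mul_one, Matrix.mul_smul, mul_transpose_mul hWW, smul_smul]
  ext
  simp only [Matrix.sub_apply, Matrix.smul_apply, smul_eq_mul]
  field_simp
  ring

theorem gramInv_mul_transpose (hp : 0 < p) (hq : 0 < q)
    (hWW : W * Wᵀ = ((1 - p * q) * p / q) • 1) : gramInv p q W * Wᵀ = (p * q) • Wᵀ := by
  have h : (gramInv p q W)ᵀ = gramInv p q W := by simp [gramInv]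
  rw [← transpose_smul, ← mul_gramInv hp hq hWW, transpose_mul, h]

theorem inv_gram (hn : 0 < n) (hp : 0 < p) (hq : 0 < q)
    (hH : H = (q / p) • (Wᵀ * labels K n)) (hWW : W * Wᵀ = ((1 - p * q) * p / q) • 1) :
    ((H * Hᵀ) ⊗ₖ (1 : Matrix (Fin K) (Fin K) ℝ)
      + ((n : ℝ) * q ^ 2) • (1 : Matrix (Fin d × Fin K) (Fin d × Fin K) ℝ))⁻¹ =
      (1 / (n * q ^ 2) : ℝ) • (gramInv p q W ⊗ₖ (1 : Matrix (Fin K) (Fin K) ℝ)) := by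
  have hn' : (n : ℝ) ≠ 0 := by positivity
  have hHH : H * Hᵀ = (n * (q / p) ^ 2 : ℝ) • (Wᵀ * W) := by
    rw [hH, transpose_smul, transpose_mul, transpose_transpose, Matrix.smul_mul, Matrix.mul_smul,
      Matrix.mul_assoc, ← Matrix.mul_assoc (labels K n), labels_mul_transpose, Matrix.smul_mul,
      Matrix.one_mul, Matrix.mul_smul, smul_smul, smul_smul]
    congr 1
    ring
  apply inv_eq_right_inv
  rw [← one_kronecker_one, ← smul_kronecker, ← add_kronecker, ← smul_kronecker,
    ← mul_kronecker_mul, Matrix.mul_one, hHH]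
  congr 1
  rw [gramInv, Matrix.mul_smul, Matrix.add_mul, Matrix.mul_sub, Matrix.mul_sub]
  simp only [Matrix.smul_mul, Matrix.mul_smul, Matrix.mul_one, Matrix.one_mul,
    transpose_mul_self_mul_self hWW]
  ext i j
  simp only [Matrix.smul_apply, Matrix.add_apply, Matrix.sub_apply, smul_eq_mul]
  field_simp
  ring

theorem matE_transpose_add_kronecker_apply (hH : H = (q / p) • (Wᵀ * labels K n))
    (hWH : W * H = (1 - p * q) • labels K n) (i : Fin d) (k : Fin K) (b : Smp K n) (j : Fin d) :
    ((matE W H)ᵀ + H ⊗ₖ W) (i, k) (b, j) =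
      -(p * q) * (if i = j then 1 else 0) * (if k = b.1 then 1 else 0)
        + q / p * W b.1 i * W k j := by
  have h1 : W * H - labels K n = -(p * q) • labels K n := by
    rw [hWH]
    ext
    simp only [Matrix.sub_apply, Matrix.smul_apply, smul_eq_mul]
    ring
  have h2 : H i b = q / p * W b.1 i := by
    rw [hH]
    simp [mul_apply, labels]
  rw [Matrix.add_apply, kronecker_apply, h2, transpose_apply, matE, h1, of_apply, vec]
  congr 1
  by_cases h : i = j
  · subst h
    by_cases hk : k = b.1 <;> simp [labels, hk]
  · simp [labels, h, Ne.symm h]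

theorem gram_inv_mul_apply (hp : 0 < p) (hq : 0 < q) (hH : H = (q / p) • (Wᵀ * labels K n))
    (hWH : W * H = (1 - p * q) • labels K n) (hWW : W * Wᵀ = ((1 - p * q) * p / q) • 1)
    (i : Fin d) (k : Fin K) (b : Smp K n) (j : Fin d) :
    ((gramInv p q W ⊗ₖ (1 : Matrix (Fin K) (Fin K) ℝ))
      * ((matE W H)ᵀ + H ⊗ₖ W)) (i, k) (b, j) =
      -(p * q) * gramInv p q W i j * (if k = b.1 then 1 else 0)
        + q ^ 2 * W b.1 i * W k j := by
  have hQ : ∑ x, gramInv p q W i x * W b.1 x = p * q * W b.1 i := by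
    have h := congrFun (congrFun (gramInv_mul_transpose hp hq hWW) i) b.1
    rwa [mul_apply] at h
  rw [mul_apply, Fintype.sum_prod_type]
  simp only [kronecker_apply, matE_transpose_add_kronecker_apply hH hWH, one_apply, mul_ite,
    mul_one, mul_zero, ite_mul, zero_mul, Finset.sum_ite_eq, Finset.mem_univ, if_true]
  generalize gramInv p q W = Q at hQ ⊢
  have : ∀ x, Q i x * ((if k = b.1 then if x = j then -(p * q) else 0 else 0)
      + q / p * W b.1 x * W k j) =
      (if x = j then (if k = b.1 then -(p * q) * Q i x else 0) else 0)
        + (q / p * W k j) * (Q i x * W b.1 x) := by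
    intro x
    split_ifs <;> ring
  simp only [this, Finset.sum_add_distrib, ← Finset.mul_sum, hQ, Finset.sum_ite_eq',
    Finset.mem_univ, if_true]
  congr 1
  field_simp

/-- Orthogonality of the rows of `W` confines most terms to a single class. The two cross terms
between the `E` part and `H ⊗ W` contribute equally, whence the factor `2`; they are the only
coupling between classes. -/
theorem matZ_apply (hn : 0 < n) (hp : 0 < p) (hq : 0 < q)
    (hH : H = (q / p) • (Wᵀ * labels K n))
    (hWH : W * H = (1 - p * q) • labels K n) (hWW : W * Wᵀ = ((1 - p * q) * p / q) • 1)
    (a b : Smp K n) (i j : Fin d) :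
    matZ (q ^ 2) W H (a, i) (b, j) = 1 / n *
      ((if a.1 = b.1 then p ^ 2 * gramInv p q W i j
          + (1 - p * q) * (Wᵀ * W) i j else 0) - 2 * (p * q) * (W b.1 i * W a.1 j)) := by
  have hW : ∀ i, ∑ x, W a.1 x * gramInv p q W x i = p * q * W a.1 i := by
    intro i
    have h := congrFun (congrFun (mul_gramInv hp hq hWW) a.1) i
    rwa [mul_apply] at h
  have hWWij : ∑ k, W k i * W k j = (Wᵀ * W) i j := by simp [mul_apply]
  have hd := dotProduct_row_row hWW a.1 b.1
  rw [matZ, inv_gram hn hp hq hH hWW, Matrix.mul_smul, Matrix.smul_mul, Matrix.mul_assoc,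
    Matrix.smul_apply, mul_apply, Fintype.sum_prod_type]
  simp only [transpose_apply ((matE W H)ᵀ + H ⊗ₖ W), gram_inv_mul_apply hp hq hH hWH hWW,
    matE_transpose_add_kronecker_apply hH hWH]
  have hn' : (n : ℝ) ≠ 0 := by positivity
  specialize hW j
  generalize gramInv p q W = Q at hW ⊢
  have : ∀ x k, (-(p * q) * (if x = i then 1 else 0) * (if k = a.1 then 1 else 0)
      + q / p * W a.1 x * W k i) *
      (-(p * q) * Q x j * (if k = b.1 then 1 else 0) + q ^ 2 * W b.1 x * W k j) =
      (if x = i then (if k = a.1 then (p * q) ^ 2 * Q x j * (if k = b.1 then 1 else 0)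
          - (p * q) * q ^ 2 * W b.1 x * W k j else 0) else 0)
      - (if k = b.1 then q ^ 2 * W k i * (W a.1 x * Q x j) else 0)
      + q ^ 3 / p * (W a.1 x * W b.1 x) * (W k i * W k j) := by
    intro x k
    split_ifs <;> field_simp <;> ring
  simp only [this, Finset.sum_add_distrib, Finset.sum_sub_distrib, ← Finset.mul_sum,
    ← Finset.sum_mul, hWWij, hd, Finset.sum_ite_eq', Finset.mem_univ, if_true]
  rw [Finset.sum_eq_single i (fun x _ hx => by simp [hx]) (by simp), hW]
  simp only [if_true, Finset.sum_ite_eq', Finset.mem_univ, smul_eq_mul]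
  by_cases hab : a.1 = b.1
  · simp only [hab, if_true]
    field_simp
    ring
  · simp only [hab, if_false]
    field_simp
    ring

end Blocks

/-! ### Combinations of tensor products of projections -/

section Spectrum

theorem kronecker_mulVec_tensor {m m' r r' : Type*} [Fintype m'] [Fintype r']
    (A : Matrix m m' ℝ) (B : Matrix r r' ℝ) (x : m' → ℝ) (y : r' → ℝ) :
    (A ⊗ₖ B) *ᵥ (fun t => x t.1 * y t.2) = fun t => (A *ᵥ x) t.1 * (B *ᵥ y) t.2 := by
  ext ⟨i, j⟩
  simp only [mulVec, dotProduct, kronecker_apply, Fintype.sum_prod_type, Finset.sum_mul_sum]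
  exact Finset.sum_congr rfl fun _ _ => Finset.sum_congr rfl fun _ _ => by ring

variable {m r : Type*} [Fintype m] [Fintype r] [DecidableEq m] [DecidableEq r]

/-- The shape of an intra-class block: `R`, `P` and `U` are orthogonal projections with
`U ≤ P`. -/
noncomputable def blockForm (β α s γ : ℝ) (R : Matrix m m ℝ) (P U : Matrix r r ℝ) :
    Matrix (m × r) (m × r) ℝ :=
  1 - β⁻¹ • (α • ((1 - R) ⊗ₖ (1 - P)) + s • ((1 - R) ⊗ₖ P) + γ • (R ⊗ₖ (P + U)))

variable {β α s γ : ℝ} {R : Matrix m m ℝ} {P U : Matrix r r ℝ}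

omit [Fintype m] [Fintype r] in
theorem isSymm_blockForm (hR : Rᵀ = R) (hP : Pᵀ = P) (hU : Uᵀ = U) :
    (blockForm β α s γ R P U).IsSymm := by
  have h (A : Matrix m m ℝ) (B : Matrix r r ℝ) : (A ⊗ₖ B)ᵀ = Aᵀ ⊗ₖ Bᵀ := rfl
  simp only [blockForm, IsSymm, transpose_sub, transpose_add, transpose_smul, transpose_one,
    h, hR, hP, hU]

theorem posSemidef_one_sub_blockForm (hβ : 0 ≤ β) (hα : 0 ≤ α) (hs : 0 ≤ s) (hγ : 0 ≤ γ)
    (hR : R.PosSemidef) (hR' : (1 - R).PosSemidef) (hP : P.PosSemidef) (hP' : (1 - P).PosSemidef)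
    (hU : U.PosSemidef) : ((1 : ℝ) • 1 - blockForm β α s γ R P U).PosSemidef := by
  rw [one_smul, blockForm, sub_sub_cancel]
  exact ((((hR'.kronecker hP').smul hα).add ((hR'.kronecker hP).smul hs)).add
    ((hR.kronecker (hP.add hU)).smul hγ)).smul (inv_nonneg.2 hβ)

/-- Splitting `s • 1` along `R` and `P`, and writing `P + U = 2P - (P - U)`, leaves a nonnegative
combination of tensor products of semidefinite matrices. -/
theorem posSemidef_blockForm_sub (hβ : 0 ≤ β) (hα : α ≤ s) (hs : 0 ≤ s) (hγ : 0 ≤ γ)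
    (hγs : 2 * γ ≤ s) (hR : R.PosSemidef) (hR' : (1 - R).PosSemidef) (hP : P.PosSemidef)
    (hP' : (1 - P).PosSemidef) (hPU : (P - U).PosSemidef) :
    (blockForm β α s γ R P U - (1 - β⁻¹ * s) • 1).PosSemidef := by
  have h : blockForm β α s γ R P U - (1 - β⁻¹ * s) • 1 =
      β⁻¹ • ((s - α) • ((1 - R) ⊗ₖ (1 - P)) + s • (R ⊗ₖ (1 - P)) + (s - 2 * γ) • (R ⊗ₖ P)
        + γ • (R ⊗ₖ (P - U))) := by
    rw [blockForm, ← one_kronecker_one]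
    ext ⟨a, i⟩ ⟨b, j⟩
    simp only [Matrix.sub_apply, Matrix.add_apply, Matrix.smul_apply, kronecker_apply, smul_eq_mul]
    ring
  rw [h]
  exact (((((hR'.kronecker hP').smul (sub_nonneg.2 hα)).add ((hR.kronecker hP').smul hs)).add
    ((hR.kronecker hP).smul (sub_nonneg.2 hγs))).add ((hR.kronecker hPU).smul hγ)).smul
    (inv_nonneg.2 hβ)

theorem blockForm_mulVec (x : m → ℝ) (y : r → ℝ) :
    blockForm β α s γ R P U *ᵥ (fun t => x t.1 * y t.2) = fun t => x t.1 * y t.2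
      - β⁻¹ * (α * ((x - R *ᵥ x) t.1 * (y - P *ᵥ y) t.2) + s * ((x - R *ᵥ x) t.1 * (P *ᵥ y) t.2)
        + γ * ((R *ᵥ x) t.1 * (P *ᵥ y + U *ᵥ y) t.2)) := by
  simp only [blockForm, sub_mulVec, add_mulVec, smul_mulVec, one_mulVec,
    kronecker_mulVec_tensor]
  rfl

theorem blockForm_mulVec_of_mem_of_ker {x : m → ℝ} {y : r → ℝ} (hx : R *ᵥ x = x)
    (hy : P *ᵥ y = 0) (hy' : U *ᵥ y = 0) :
    blockForm β α s γ R P U *ᵥ (fun t => x t.1 * y t.2) = (1 : ℝ) • fun t => x t.1 * y t.2 := by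
  rw [blockForm_mulVec, hx, hy, hy']
  ext t
  simp

theorem blockForm_mulVec_of_ker_of_mem {x : m → ℝ} {y : r → ℝ} (hx : R *ᵥ x = 0)
    (hy : P *ᵥ y = y) :
    blockForm β α s γ R P U *ᵥ (fun t => x t.1 * y t.2) =
      (1 - β⁻¹ * s) • fun t => x t.1 * y t.2 := by
  rw [blockForm_mulVec, hx, hy]
  ext t
  simp
  ring

omit [Fintype m] [Fintype r] [DecidableEq m] [DecidableEq r] in
theorem tensor_ne_zero {x : m → ℝ} {y : r → ℝ} (hx : x ≠ 0) (hy : y ≠ 0) :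
    (fun t : m × r => x t.1 * y t.2) ≠ 0 := by
  obtain ⟨i, hi⟩ := Function.ne_iff.1 hx
  obtain ⟨j, hj⟩ := Function.ne_iff.1 hy
  exact fun h => mul_ne_zero hi hj (congrFun h (i, j))

end Spectrum

/-! ### Averaging over the samples of a class -/

section Averaging

/-- The averaging projection `n⁻¹ 1 1ᵀ`. -/
noncomputable def avg (n : ℕ) : Matrix (Fin n) (Fin n) ℝ := Matrix.of fun _ _ => (n : ℝ)⁻¹

theorem avg_transpose (n : ℕ) : (avg n)ᵀ = avg n := rfl

theorem avg_mul_self {n : ℕ} (hn : 0 < n) : avg n * avg n = avg n := by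
  have : (n : ℝ) ≠ 0 := by positivity
  ext i j
  simp [mul_apply, avg, this]

theorem avg_mulVec (n : ℕ) (x : Fin n → ℝ) : avg n *ᵥ x = fun _ => (n : ℝ)⁻¹ * ∑ i, x i := by
  ext i
  simp [mulVec, dotProduct, avg, Finset.mul_sum]

theorem posSemidef_one_sub {m : Type*} [Fintype m] [DecidableEq m] {A : Matrix m m ℝ}
    (hs : Aᵀ = A) (h : A * A = A) : (1 - A).PosSemidef := by
  refine posSemidef_of_isSymm_of_mul_self (by simp [hs]) ?_
  simp [Matrix.sub_mul, Matrix.mul_sub, h]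

end Averaging

/-! ### The class blocks of `F` -/

section ClassBlocks

variable {d K n : ℕ} {p q : ℝ} {W : Matrix (Fin K) (Fin d) ℝ} {H : Matrix (Fin d) (Smp K n) ℝ}

theorem matF_apply (hn : 0 < n) (hp : 0 < p) (hq : 0 < q)
    (hH : H = (q / p) • (Wᵀ * labels K n))
    (hWH : W * H = (1 - p * q) • labels K n) (hWW : W * Wᵀ = ((1 - p * q) * p / q) • 1) (β : ℝ)
    (a b : Smp K n) (i j : Fin d) :
    matF (q ^ 2) (p ^ 2) β W H (a, i) (b, j) =
      (1 - p ^ 2 / β) * ((if a = b then 1 else 0) * (if i = j then 1 else 0))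
        - 1 / β * ((if a = b then 1 else 0) * (Wᵀ * W) i j)
        + 1 / β * (1 / n *
      ((if a.1 = b.1 then p ^ 2 * gramInv p q W i j
          + (1 - p * q) * (Wᵀ * W) i j else 0) - 2 * (p * q) * (W b.1 i * W a.1 j))) := by
  rw [matF, ← one_kronecker_one]
  simp only [Matrix.sub_apply, Matrix.add_apply, Matrix.smul_apply, kronecker_apply, smul_eq_mul,
    matZ_apply hn hp hq hH hWH hWW, one_apply]
  ring

theorem classBlock_self (hn : 0 < n) (hp : 0 < p) (hq : 0 < q) (hpq : p * q < 1)
    (hH : H = (q / p) • (Wᵀ * labels K n))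
    (hWH : W * H = (1 - p * q) • labels K n) (hWW : W * Wᵀ = ((1 - p * q) * p / q) • 1) (β : ℝ)
    (k : Fin K) :
    classBlock (matF (q ^ 2) (p ^ 2) β W H) k k =
      blockForm β (p ^ 2) (p / q) (2 * (p / q) * (p * q) * (1 - p * q)) (avg n)
        (((1 - p * q) * p / q)⁻¹ • (Wᵀ * W))
        (((1 - p * q) * p / q)⁻¹ • vecMulVec (W k) (W k)) := by
  have hn' : (n : ℝ) ≠ 0 := by positivity
  have h1 : 1 - p * q ≠ 0 := by linarith
  rw [blockForm, ← one_kronecker_one]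
  ext ⟨x, i⟩ ⟨y, j⟩
  simp only [classBlock, submatrix_apply, matF_apply hn hp hq hH hWH hWW, gramInv,
    Matrix.sub_apply, Matrix.add_apply, Matrix.smul_apply, kronecker_apply, smul_eq_mul,
    one_apply, avg, of_apply, vecMulVec_apply, Prod.mk.injEq, true_and, if_true]
  generalize (Wᵀ * W) i j = g
  generalize (if x = y then (1 : ℝ) else 0) = e
  generalize (if i = j then (1 : ℝ) else 0) = f
  field_simp
  ring

theorem classBlock_of_ne (hn : 0 < n) (hp : 0 < p) (hq : 0 < q)
    (hH : H = (q / p) • (Wᵀ * labels K n))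
    (hWH : W * H = (1 - p * q) • labels K n) (hWW : W * Wᵀ = ((1 - p * q) * p / q) • 1) (β : ℝ)
    {k l : Fin K} (hkl : k ≠ l) :
    classBlock (matF (q ^ 2) (p ^ 2) β W H) k l =
      vecMulVec (fun t : Fin n × Fin d => -(2 * (p * q) / (n * β)) * W l t.2)
        (fun t : Fin n × Fin d => W k t.2) := by
  ext ⟨x, i⟩ ⟨y, j⟩
  simp only [classBlock, submatrix_apply, matF_apply hn hp hq hH hWH hWW, vecMulVec_apply,
    Prod.mk.injEq, hkl, false_and, if_false]
  ring

end ClassBlocks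

/-! ### Rank and extreme singular values of the blocks -/

section BlockSpectra

variable {d K n : ℕ} {W : Matrix (Fin K) (Fin d) ℝ}

theorem row_ne_zero {a : ℝ} (ha : a ≠ 0) (hWW : W * Wᵀ = a • 1) (k : Fin K) : W k ≠ 0 := by
  intro h
  have := dotProduct_row_row hWW k k
  simp [h] at this
  exact ha this.symm

theorem exists_ne_zero_mulVec_eq_zero (hdK : K < d) (W : Matrix (Fin K) (Fin d) ℝ) :
    ∃ u : Fin d → ℝ, u ≠ 0 ∧ W *ᵥ u = 0 := by
  obtain ⟨u, hu, hu0⟩ := (Submodule.ne_bot_iff _).1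
    (LinearMap.ker_ne_bot_of_finrank_lt (f := W.mulVecLin) (by simpa using hdK))
  exact ⟨u, hu0, hu⟩

theorem spectrum_blockForm (hdK : K < d) (hn : 0 < n) {a β α s γ : ℝ} (ha : 0 < a) (hα : 0 ≤ α)
    (hαs : α ≤ s) (hγ : 0 ≤ γ) (hγs : 2 * γ ≤ s) (hs : 0 < s) (hβ : s < β)
    (hWW : W * Wᵀ = a • 1) (k : Fin K) :
    let F := blockForm β α s γ (avg n) (a⁻¹ • (Wᵀ * W)) (a⁻¹ • vecMulVec (W k) (W k))
    F.rank = d * n ∧ sigmaMax F = 1 ∧ (2 ≤ n → sigmaMin F = 1 - β⁻¹ * s) := by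
  intro F
  have hβ0 : 0 < β := hs.trans hβ
  have hμ : 0 < 1 - β⁻¹ * s := by
    rw [sub_pos, inv_mul_lt_iff₀ hβ0]
    linarith
  have hWWk : W *ᵥ W k = a • Pi.single k 1 := by
    ext l
    have := dotProduct_row_row hWW l k
    simpa [mulVec, dotProduct, Pi.single_apply] using this
  have hkk : W k ⬝ᵥ W k = a := by simpa [dotProduct] using dotProduct_row_row hWW k k
  set P := a⁻¹ • (Wᵀ * W) with hPdef
  set U := a⁻¹ • vecMulVec (W k) (W k) with hUdef
  have hPt : Pᵀ = P := by simp [hPdef]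
  have hUt : Uᵀ = U := by simp [hUdef]
  have hPP : P * P = P := by
    rw [hPdef, Matrix.smul_mul, Matrix.mul_smul, transpose_mul_self_mul_self hWW, smul_smul a⁻¹ a,
      inv_mul_cancel₀ ha.ne', one_smul]
  have hPk : P *ᵥ W k = W k := by
    rw [hPdef, smul_mulVec, ← mulVec_mulVec, hWWk, mulVec_smul, smul_smul,
      inv_mul_cancel₀ ha.ne', one_smul]
    ext j
    simp
  have hPU : P * U = U := by rw [hUdef, Matrix.mul_smul, mul_vecMulVec, hPk]
  have hUP : U * P = U := by
    have := congrArg transpose hPU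
    rwa [transpose_mul, hPt, hUt] at this
  have hUU : U * U = U := by
    rw [hUdef, Matrix.smul_mul, Matrix.mul_smul, vecMulVec_mul_vecMulVec, hkk, vecMulVec_smul,
      smul_smul a⁻¹ a, inv_mul_cancel₀ ha.ne', one_smul]
  have hR := posSemidef_of_isSymm_of_mul_self (avg_transpose n) (avg_mul_self hn)
  have hR' := posSemidef_one_sub (avg_transpose n) (avg_mul_self hn)
  have hPp := posSemidef_of_isSymm_of_mul_self hPt hPP
  have hPp' := posSemidef_one_sub hPt hPP
  have hUp := posSemidef_of_isSymm_of_mul_self hUt hUU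
  have hPUp : (P - U).PosSemidef := posSemidef_of_isSymm_of_mul_self (by simp [hPt, hUt])
    (by simp [Matrix.sub_mul, Matrix.mul_sub, hPP, hPU, hUP, hUU])
  have hsymm : F.IsSymm := isSymm_blockForm (avg_transpose n) hPt hUt
  have hup := posSemidef_one_sub_blockForm hβ0.le hα hs.le hγ hR hR' hPp hPp' hUp
  have hlow := posSemidef_blockForm_sub hβ0.le hαs hs.le hγ hγs hR hR' hPp hPp' hPUp
  have hsv {i : ℕ} (hi : i < Fintype.card (Fin n × Fin d)) :=
    singularValues_mem_Icc hsymm hμ hlow hup hi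
  have hn' : (n : ℝ) ≠ 0 := by positivity
  refine ⟨?_, ?_, fun hn2 => ?_⟩
  · rw [rank_eq_card_of_posSemidef_sub hμ hlow]
    simp [mul_comm]
  -- The bound `1` is attained at `1 ⊗ u`, constant over samples, with `u` in the kernel of `W`,
  -- which is nonzero as `K < d`.
  · obtain ⟨u, hu, hWu⟩ := exists_ne_zero_mulVec_eq_zero hdK W
    have hku : W k ⬝ᵥ u = 0 := congrFun hWu k
    have hPu : P *ᵥ u = 0 := by
      rw [hPdef, smul_mulVec, ← mulVec_mulVec, hWu, mulVec_zero, smul_zero]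
    have hUu : U *ᵥ u = 0 := by
      rw [hUdef, smul_mulVec, vecMulVec_mulVec, hku]
      simp
    have h1 : (fun _ : Fin n => (1 : ℝ)) ≠ 0 := fun h => one_ne_zero (congrFun h ⟨0, hn⟩)
    refine sigmaMax_eq_of_forall_le F zero_le_one
      (tensor_ne_zero h1 hu)
      (transpose_mul_self_mulVec_of_eigenvector hsymm
        (blockForm_mulVec_of_mem_of_ker (x := fun _ => 1) ?_ hPu hUu)) fun i hi => (hsv hi).2
    rw [avg_mulVec]
    simp [hn']
  -- The lower bound is attained at `(e₀ - e₁) ⊗ W k`; a nonzero vector of mean zero needs two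
  -- samples.
  · let i₀ : Fin n := ⟨0, by omega⟩
    let i₁ : Fin n := ⟨1, by omega⟩
    have h01 : i₀ ≠ i₁ := by simp [i₀, i₁]
    have hx : (Pi.single i₀ 1 - Pi.single i₁ 1 : Fin n → ℝ) ≠ 0 := by
      intro h
      simpa [h01] using congrFun h i₀
    refine sigmaMin_eq_of_forall_le F hμ.le (tensor_ne_zero hx (row_ne_zero ha.ne' hWW k))
      (transpose_mul_self_mulVec_of_eigenvector hsymm
        (blockForm_mulVec_of_ker_of_mem ?_ hPk)) fun i hi => (hsv hi).1
    rw [avg_mulVec]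
    ext
    simp [Finset.sum_sub_distrib]

theorem spectrum_classBlock_of_ne (hn : 0 < n) {a b τ : ℝ} (ha : 0 < a) (hb : b ≠ 0)
    (hτ : 0 ≤ τ) (hτb : τ = |b| * (n * a)) (hWW : W * Wᵀ = a • 1) (k l : Fin K) :
    let F := vecMulVec (fun t : Fin n × Fin d => b * W l t.2) (fun t : Fin n × Fin d => W k t.2)
    F.rank = 1 ∧ sigmaMax F = τ := by
  intro F
  have hne (m : Fin K) {c : ℝ} (hc : c ≠ 0) : (fun t : Fin n × Fin d => c * W m t.2) ≠ 0 :=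
    tensor_ne_zero (x := fun _ : Fin n => c) (fun h => hc (congrFun h ⟨0, hn⟩))
      (row_ne_zero ha.ne' hWW m)
  have hk : (fun t : Fin n × Fin d => W k t.2) ≠ 0 := by simpa using hne k one_ne_zero
  have hd (m : Fin K) : ∑ i, W m i * W m i = a := by simpa using dotProduct_row_row hWW m m
  refine ⟨rank_vecMulVec_eq_one (hne l hb) hk, sigmaMax_vecMulVec hk hτ ?_⟩
  simp only [dotProduct, Fintype.sum_prod_type, hd, mul_mul_mul_comm b, ← Finset.mul_sum,
    Finset.sum_const, Finset.card_univ, Fintype.card_fin, nsmul_eq_mul]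
  rw [hτb, mul_pow, sq_abs]
  ring

end BlockSpectra

end UFM

open UFM in
theorem mainTheorem3 {d K n : ℕ} (hdK : K < d) (hn : 1 ≤ n)
    (lamW lamH β : ℝ) (hW : 0 < lamW) (hH : 0 < lamH) (hc : lamH * lamW < 1)
    (hβ : Real.sqrt (lamH / lamW) < β)
    (H₀ : Matrix (Fin d) (UFM.Smp K n) ℝ)
    (hH₀ : ∃ W₀ : Matrix (Fin K) (Fin d) ℝ, UFM.IsUfmMinimizer lamW lamH W₀ H₀)
    (W : Matrix (Fin K) (Fin d) ℝ) (H : Matrix (Fin d) (UFM.Smp K n) ℝ)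
    (hmin : UFM.IsPenMinimizer lamW lamH β H₀ W H) :
    (∀ k : Fin K,
      (UFM.classBlock (UFM.matF lamW lamH β W H) k k).rank = d * n ∧
      UFM.sigmaMax (UFM.classBlock (UFM.matF lamW lamH β W H) k k) = 1 ∧
      (2 ≤ n → UFM.sigmaMin (UFM.classBlock (UFM.matF lamW lamH β W H) k k)
        = 1 - β⁻¹ * Real.sqrt (lamH / lamW))) ∧
    (∀ k l : Fin K, k ≠ l →
      (UFM.classBlock (UFM.matF lamW lamH β W H) k l).rank = 1 ∧
      UFM.sigmaMax (UFM.classBlock (UFM.matF lamW lamH β W H) k l)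
        = 2 * β⁻¹ * lamH * (1 - Real.sqrt (lamH * lamW))) := by
  obtain ⟨p, hp, rfl⟩ : ∃ p : ℝ, 0 < p ∧ lamH = p ^ 2 :=
    ⟨√lamH, Real.sqrt_pos.2 hH, (Real.sq_sqrt hH.le).symm⟩
  obtain ⟨q, hq, rfl⟩ : ∃ q : ℝ, 0 < q ∧ lamW = q ^ 2 :=
    ⟨√lamW, Real.sqrt_pos.2 hW, (Real.sq_sqrt hW.le).symm⟩
  rw [← div_pow, Real.sqrt_sq (by positivity)] at hβ ⊢
  rw [← mul_pow, Real.sqrt_sq (by positivity)]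
  have hpq0 : 0 < p * q := mul_pos hp hq
  have hpq : p * q < 1 := by
    rw [← mul_pow] at hc
    exact (sq_lt_one_iff₀ hpq0.le).1 hc
  have hs : 0 < p / q := div_pos hp hq
  have hβ0 : 0 < β := hs.trans hβ
  have hu := hmin.isUfmMinimizer hβ0.le hH₀
  -- Positivity of `K` is supplied later by the class index `k`.
  have key (hK : 0 < K) := hu.collapse hdK.le hK hn hp hq hpq
  have h1 : 0 < 1 - p * q := by linarith
  have ha : 0 < (1 - p * q) * p / q := by positivity
  refine ⟨fun k => ?_, fun k l hkl => ?_⟩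
  · obtain ⟨e1, e2, e3⟩ := key k.pos
    rw [classBlock_self hn hp hq hpq e1 e2 e3]
    refine spectrum_blockForm hdK hn ha (by positivity) ?_ (by positivity) ?_ hs hβ e3 k
    · rw [show p ^ 2 = p / q * (p * q) by field_simp]
      nlinarith
    -- Here `p/q - 2γ = (p/q)(1 - 2pq)²`.
    · nlinarith [sq_nonneg (1 - 2 * (p * q))]
  · obtain ⟨e1, e2, e3⟩ := key k.pos
    rw [classBlock_of_ne hn hp hq e1 e2 e3 β hkl]
    have hn' : (0 : ℝ) < n := by exact_mod_cast hn
    have hpos : 0 < 2 * (p * q) / (n * β) := by positivity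
    refine spectrum_classBlock_of_ne hn ha ?_ (by positivity) ?_ e3 k l
    · exact neg_ne_zero.2 hpos.ne'
    -- The norm is `2pq/(nβ) · n a = 2p²(1 - pq)/β`.
    · rw [abs_neg, abs_of_pos hpos]
      field_simp
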